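/- Let $F_0$ be a fixed finite simple graph and let $k,r,m$ be integers with $2\le k<r<m$ and $m=\chi(F_0)$. Let $F_0^{+k}$ be the $k$-uniform expansion of $F_0$, obtained by adding $k-2$ new vertices to each edge of $F_0$, the new vertices being distinct for distinct edges. Let $\mathrm{ex}_r(n,\mathrm{Berge}_r\text{-}F_0^{+k})$ be the maximum number of hyperedges in an $r$-uniform hypergraph on $n$ vertices that has no sub-hypergraph that is an $r$-uniform Berge copy of $F_0^{+k}$; here a hypergraph $\mathcal H$ is a Berge copy of a hypergraph $\mathcal F$ if, up to renaming the vertices of $\mathcal F$, $V(\mathcal F)\subseteq V(\mathcal H)$ and there is a bijection $f:E(\mathcal F)\to E(\mathcal H)$ with $h\subseteq f(h)$ for every $h\in E(\mathcal F)$. Let $T^r(n,m-1)$ be the Turán hypergraph: its $n$ vertices are partitioned into $m-1$ parts whose sizes differ pairwise by at most $1$, and its hyperedges are all $r$-sets of vertices that meet every part in at most one vertex. Then, as $n\to\infty$, $$\mathrm{ex}_r(n,\mathrm{Berge}_r\text{-}F_0^{+k})=(1+o(1))\,|E(T^r(n,m-1))|.$$ -/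

import Mathlib

namespace BergeHypergraph

/-- Every hyperedge has exactly `r` vertices. -/
def IsUniform {α : Type*} (H : Hypergraph α) (r : ℕ) : Prop :=
  ∀ e ∈ H.edgeSet, e.encard = r

/-- `H'` is a (not necessarily induced) sub-hypergraph of `H`. -/
def IsSubhypergraph {α : Type*} (H' H : Hypergraph α) : Prop :=
  H'.vertexSet ⊆ H.vertexSet ∧ H'.edgeSet ⊆ H.edgeSet

/-- `H` is a Berge copy of `F`: after identifying the vertices of `F` with distinct vertices of `H`
(by `φ`), there is a bijection `f` from the hyperedges of `F` to the hyperedges of `H` such that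
each hyperedge `h` of `F` is contained in `f h`. -/
def IsBergeCopy {α β : Type*} (F : Hypergraph α) (H : Hypergraph β) : Prop :=
  ∃ (φ : F.vertexSet ↪ H.vertexSet) (f : F.edgeSet ≃ H.edgeSet),
    ∀ (h : F.edgeSet) (v : F.vertexSet), (v : α) ∈ (h : Set α) → (φ v : β) ∈ (f h : Set β)

/-- The family of `r`-uniform Berge copies of `F`, among hypergraphs with vertices from `β`. -/
def bergeFamily {α : Type*} (r : ℕ) (F : Hypergraph α) (β : Type*) : Set (Hypergraph β) :=
  {H | IsUniform H r ∧ IsBergeCopy F H}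

/-- The maximum number of hyperedges in an `r`-uniform hypergraph with vertex set `Fin n` that
contains no member of the family `C` as a sub-hypergraph. -/
noncomputable def ex (r n : ℕ) (C : Set (Hypergraph (Fin n))) : ℕ :=
  sSup {N | ∃ H : Hypergraph (Fin n), H.vertexSet = Set.univ ∧ IsUniform H r ∧
    (∀ H' ∈ C, ¬ IsSubhypergraph H' H) ∧ H.edgeSet.ncard = N}

/-- For `2 ≤ k`, the `k`-uniform expansion of a graph `G`: each edge `e` is enlarged by `k - 2` new
vertices `(e, i)`, the new vertices being distinct for distinct edges. -/
def expansion {V : Type*} (G : SimpleGraph V) (k : ℕ) :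
    Hypergraph (V ⊕ (G.edgeSet × Fin (k - 2))) where
  vertexSet := Set.univ
  edgeSet := Set.range fun e : G.edgeSet =>
    Sum.inl '' {v | v ∈ (e : Sym2 V)} ∪ Sum.inr '' {p | p.1 = e}
  subset_vertexSet_of_mem_edgeSet' := fun _ _ => Set.subset_univ _

/-- The Turán hypergraph `T^r(n, s)` for `s ≥ 1`: the vertex set `Fin n` is partitioned into the `s`
residue classes modulo `s` (whose sizes differ pairwise by at most `1`), and the hyperedges are the
`r`-sets that meet every part in at most one vertex. -/
def turanHypergraph (r n s : ℕ) : Hypergraph (Fin n) where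
  vertexSet := Set.univ
  edgeSet := {e | e.encard = r ∧ ∀ j < s, {v ∈ e | (v : ℕ) % s = j}.Subsingleton}
  subset_vertexSet_of_mem_edgeSet' := fun _ _ => Set.subset_univ _

end BergeHypergraph

/-!
Put `s = m - 1`. Both sides are asymptotic to `C(s, r) (n / s) ^ r`.

The Turán hypergraph contains no Berge copy of the expansion of `F₀`, because the residues modulo
`s` of the vertices of such a copy would be a proper colouring of `F₀` with `s` colours. Its
hyperedges are the `r`-cliques of the Turán graph with `s` parts, and extending cliques vertex by
vertex shows that there are at least `C(s, r) ⌊n / s⌋ ^ r` of them.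

For the upper bound, call a pair of vertices of an `r`-uniform hypergraph robust if, after any
`L` other vertices are forbidden (`L` a constant), some hyperedge still contains the pair. The
hyperedges that contain a pair which is not robust number only `O(n ^ (r - 1))`
(`card_le_card_cliqueFinset_robustGraph_add`), and all others are `r`-cliques of the graph of
robust pairs. A copy of `F₀` in that graph extends greedily to a Berge copy of the expansion
(`exists_bergeCopy_of_copy`), so it remains to bound the number of `r`-cliques in a graph with no
copy of `F₀` (`exists_card_cliqueFinset_le_of_free_of_colorable`). Such a graph has only `o(n ^ m)`
cliques of size `m`, as by Erdős's theorem (`exists_box_of_dense`) a positive density of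
`m`-cliques would yield a large blow-up of an `m`-clique, which contains `F₀`. The Moon–Moser
inequality (`moon_moser`) then bounds the ratios of the numbers of cliques of consecutive sizes, by
downward induction from size `m`, and the product of these bounds is the required one.
-/

namespace SimpleGraph

/-! ### Clique counts: the Moon–Moser inequality -/

section CliqueCounts

open Finset

/-- The common neighbours of a set `C` of vertices. -/
def commonNbrFinset {α : Type*} [Fintype α] (G : SimpleGraph α) [DecidableRel G.Adj]
    (C : Finset α) : Finset α :=
  {v | ∀ c ∈ C, G.Adj c v}

variable {α : Type*} [Fintype α] (G : SimpleGraph α) [DecidableRel G.Adj]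

lemma mem_commonNbrFinset {C : Finset α} {v : α} :
    v ∈ G.commonNbrFinset C ↔ ∀ c ∈ C, G.Adj c v := by
  simp [commonNbrFinset]

variable [DecidableEq α]

/-- A clique with a marked vertex is a smaller clique together with a common neighbour. -/
lemma sum_cliqueFinset_succ_sum_erase (s : ℕ) (f : Finset α → α → ℕ) :
    ∑ A ∈ G.cliqueFinset (s + 1), ∑ y ∈ A, f (A.erase y) y =
      ∑ C ∈ G.cliqueFinset s, ∑ y ∈ G.commonNbrFinset C, f C y := by
  rw [Finset.sum_sigma', Finset.sum_sigma']
  refine Finset.sum_bij' (fun p _ => ⟨p.1.erase p.2, p.2⟩) (fun p _ => ⟨insert p.2 p.1, p.2⟩)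
    ?_ ?_ ?_ ?_ ?_
  · rintro ⟨A, y⟩ h
    simp only [mem_sigma, mem_cliqueFinset_iff, mem_commonNbrFinset, mem_erase] at h ⊢
    refine ⟨⟨h.1.1.subset (by simp), ?_⟩, fun c hc => h.1.1 hc.2 h.2 hc.1⟩
    rw [card_erase_of_mem h.2, h.1.2]
    rfl
  · rintro ⟨C, y⟩ h
    simp only [mem_sigma, mem_cliqueFinset_iff, mem_commonNbrFinset] at h ⊢
    exact ⟨h.1.insert fun b hb => (h.2 b hb).symm, mem_insert_self _ _⟩
  · rintro ⟨A, y⟩ h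
    simp only [mem_sigma] at h
    simp [insert_erase h.2]
  · rintro ⟨C, y⟩ h
    simp only [mem_sigma, mem_commonNbrFinset] at h
    have : y ∉ C := fun hy => G.loopless.irrefl y (h.2 y hy)
    simp [erase_insert this]
  · rintro ⟨A, y⟩ _
    rfl

lemma sum_card_commonNbrFinset (s : ℕ) :
    ∑ C ∈ G.cliqueFinset s, #(G.commonNbrFinset C) = (s + 1) * #(G.cliqueFinset (s + 1)) := by
  have h := G.sum_cliqueFinset_succ_sum_erase s fun _ _ => 1
  simp only [sum_const, smul_eq_mul, mul_one] at h
  rw [← h, Finset.sum_congr rfl fun A hA => (G.mem_cliqueFinset_iff.1 hA).2]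
  simp [mul_comm]

/-- If `x` misses some vertex `z` of `A`, then `x` is joined to all of `A` minus a vertex only
when that vertex is `z`. -/
lemma sum_mem_commonNbrFinset_erase_le (A : Finset α) (s : ℕ) (hA : #A = s + 1) (x : α) :
    ∑ y ∈ A, (if x ∈ G.commonNbrFinset (A.erase y) then 1 else 0) ≤
      1 + s * (if x ∈ G.commonNbrFinset A then 1 else 0) := by
  split_ifs with hx
  · calc _ ≤ ∑ y ∈ A, 1 := Finset.sum_le_sum fun y _ => by split_ifs <;> simp
      _ = 1 + s * 1 := by simp [hA, add_comm]
  · rw [mem_commonNbrFinset] at hx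
    push Not at hx
    obtain ⟨z, hz, hzx⟩ := hx
    calc _ ≤ ∑ y ∈ A, (if y = z then 1 else 0) := by
          refine Finset.sum_le_sum fun y _ => ?_
          by_cases hyz : y = z
          · simp only [hyz, if_true]
            split_ifs <;> simp
          · rw [if_neg]
            · simp
            · rw [mem_commonNbrFinset]
              exact fun h => hzx (h z (mem_erase.2 ⟨Ne.symm hyz, hz⟩))
      _ ≤ 1 + s * 0 := by simp [hz]

lemma sum_sq_card_commonNbrFinset_le (s : ℕ) :
    ∑ C ∈ G.cliqueFinset s, #(G.commonNbrFinset C) ^ 2 ≤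
      Fintype.card α * #(G.cliqueFinset (s + 1)) +
        s * ((s + 2) * #(G.cliqueFinset (s + 2))) := by
  have h := G.sum_cliqueFinset_succ_sum_erase s fun C _ => #(G.commonNbrFinset C)
  simp only [sum_const, smul_eq_mul, ← sq] at h
  have hcard (C : Finset α) :
      #(G.commonNbrFinset C) = ∑ x : α, if x ∈ G.commonNbrFinset C then 1 else 0 := by
    simp
  rw [← h, ← G.sum_card_commonNbrFinset (s + 1)]
  calc _ ≤ ∑ A ∈ G.cliqueFinset (s + 1), (Fintype.card α + s * #(G.commonNbrFinset A)) := by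
        refine Finset.sum_le_sum fun A hA => ?_
        rw [Finset.sum_congr rfl fun y _ => hcard (A.erase y), Finset.sum_comm]
        refine (Finset.sum_le_sum fun x _ => G.sum_mem_commonNbrFinset_erase_le A s
          (G.mem_cliqueFinset_iff.1 hA).2 x).trans ?_
        rw [sum_add_distrib, ← mul_sum, ← hcard]
        simp
    _ = _ := by
        rw [sum_add_distrib, ← mul_sum]
        simp [mul_comm]

/-- The **Moon–Moser inequality** between the numbers of cliques of three consecutive sizes: it is
the Cauchy–Schwarz inequality for the number of ways to extend an `s`-clique. -/
lemma moon_moser (s : ℕ) :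
    ((s + 1) * #(G.cliqueFinset (s + 1))) ^ 2 ≤ #(G.cliqueFinset s) *
      (Fintype.card α * #(G.cliqueFinset (s + 1)) +
        s * ((s + 2) * #(G.cliqueFinset (s + 2)))) := by
  rw [← G.sum_card_commonNbrFinset s]
  exact sq_sum_le_card_mul_sum_sq.trans (Nat.mul_le_mul_left _ (G.sum_sq_card_commonNbrFinset_le s))

lemma card_cliqueFinset_le_pow (s : ℕ) : #(G.cliqueFinset s) ≤ Fintype.card α ^ s :=
  G.card_cliqueFinset_le.trans (Nat.choose_le_pow _ _)

end CliqueCounts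

/-! ### Clique counts in graphs with few cliques of size `p + 1` -/

open Finset in
/-- If a graph has few `(p + 1)`-cliques, then the ratio of the numbers of `(j + 1)`-cliques and
`j`-cliques is essentially at most the one of the Turán graph with `p` parts. This is proved by
downward induction on `j` from the Moon–Moser inequality. -/
lemma exists_card_cliqueFinset_succ_le (p j : ℕ) (hj : j ≤ p) (ε : ℝ) (hε : 0 < ε) :
    ∃ δ : ℝ, 0 < δ ∧ ∀ (α : Type) [Fintype α] [DecidableEq α] (G : SimpleGraph α)
      [DecidableRel G.Adj],
      (#(G.cliqueFinset (p + 1)) : ℝ) ≤ δ * (Fintype.card α : ℝ) ^ (p + 1) →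
      ((j + 1) * p * #(G.cliqueFinset (j + 1)) : ℝ) ≤
        (p - j) * Fintype.card α * #(G.cliqueFinset j) + ε * (Fintype.card α : ℝ) ^ (j + 1) := by
  induction hd : p - j generalizing j ε with
  | zero =>
    obtain rfl : j = p := by omega
    refine ⟨ε / ((j + 1) * (j + 1)), by positivity, fun α _ _ G _ h => ?_⟩
    have hj0 : (0 : ℝ) ≤ j := j.cast_nonneg
    calc ((j + 1) * j * #(G.cliqueFinset (j + 1)) : ℝ)
        ≤ (j + 1) * (j + 1) * #(G.cliqueFinset (j + 1)) := by gcongr; linarith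
      _ ≤ (j + 1) * (j + 1) * (ε / ((j + 1) * (j + 1)) * (Fintype.card α : ℝ) ^ (j + 1)) := by
        gcongr
      _ = _ := by field_simp; ring
  | succ d ih =>
    have hjp : j + 1 ≤ p := by omega
    -- an error `ε' n ^ (j + 2)` in the next ratio becomes about `√(p j ε') n ^ (j + 1)` in this one,
    -- as the Moon–Moser inequality is quadratic
    obtain ⟨δ, hδ, H⟩ := ih (j + 1) hjp (ε ^ 2 / (p * j + 1)) (by positivity) (by omega)
    refine ⟨δ, hδ, fun α _ _ G _ h => ?_⟩
    have h2 := H α G h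
    have h1 := (Nat.cast_le (α := ℝ)).2 (G.moon_moser j)
    have h0 : (#(G.cliqueFinset j) : ℝ) ≤ (Fintype.card α : ℝ) ^ j := by
      exact_mod_cast G.card_cliqueFinset_le_pow j
    have hbn : (#(G.cliqueFinset (j + 1)) : ℝ) ≤ (Fintype.card α : ℝ) ^ (j + 1) := by
      exact_mod_cast G.card_cliqueFinset_le_pow (j + 1)
    push_cast at h1 h2
    rw [show (j : ℝ) + 1 + 1 = j + 2 by ring] at h2
    set n : ℝ := (Fintype.card α : ℝ)
    set a : ℝ := (#(G.cliqueFinset j) : ℝ)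
    set b : ℝ := (#(G.cliqueFinset (j + 1)) : ℝ)
    set c : ℝ := (#(G.cliqueFinset (j + 2)) : ℝ)
    have ha : 0 ≤ a := by positivity
    have hb : 0 ≤ b := by positivity
    have hn : 0 ≤ n := by positivity
    have hj0 : (0 : ℝ) ≤ j := j.cast_nonneg
    have hp0 : (0 : ℝ) ≤ p := p.cast_nonneg
    have hpj : (0 : ℝ) ≤ p - j := by
      rw [sub_nonneg]; exact_mod_cast hj
    by_contra! hcon
    set X : ℝ := ε * n ^ (j + 1)
    have hX : 0 ≤ X := by positivity
    -- the Moon–Moser inequality and the bound for the next ratio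
    have key : (j + 1) * b * ((j + 1) * p * b - (p - j) * n * a) ≤
        j * (ε ^ 2 / (p * j + 1)) * (a * n ^ (j + 2)) := by
      have e1 := mul_le_mul_of_nonneg_left h1 hp0
      have e2 := mul_le_mul_of_nonneg_left h2 (mul_nonneg ha hj0)
      simp only [show j + 1 + 1 = j + 2 by ring] at e2
      linear_combination e1 + e2
    have hlow : X ≤ (j + 1) * p * b - (p - j) * n * a := by linarith
    have hlow' : X < (j + 1) * b * p := by
      have : 0 ≤ (p - j) * n * a := by positivity
      linarith
    have e3 : X * X ≤ p * (j * (ε ^ 2 / (p * j + 1)) * (n ^ j * n ^ (j + 2))) := by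
      calc X * X ≤ ((j + 1) * b * p) * ((j + 1) * p * b - (p - j) * n * a) := by gcongr
        _ = p * ((j + 1) * b * ((j + 1) * p * b - (p - j) * n * a)) := by ring
        _ ≤ p * (j * (ε ^ 2 / (p * j + 1)) * (a * n ^ (j + 2))) := by gcongr
        _ ≤ _ := by gcongr
    have hnpos : 0 < n := by
      rcases hn.lt_or_eq with h | h
      · exact h
      · exfalso
        rw [← h, zero_pow (by omega)] at hbn
        have : b = 0 := le_antisymm hbn hb
        rw [this] at hlow'
        linarith
    have e4 : p * (j * (ε ^ 2 / (p * j + 1)) * (n ^ j * n ^ (j + 2))) < X * X := by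
      have : X * X - p * (j * (ε ^ 2 / (p * j + 1)) * (n ^ j * n ^ (j + 2))) =
          (ε * n ^ (j + 1)) ^ 2 / (p * j + 1) := by
        simp only [X]
        field_simp
        ring
      have : 0 < (ε * n ^ (j + 1)) ^ 2 / (p * j + 1) := by positivity
      linarith
    linarith

open Finset in
/-- A graph with few `(p + 1)`-cliques has at most about as many `r`-cliques as the Turán graph
with `p` parts. -/
lemma exists_card_cliqueFinset_le (p : ℕ) (hp : 0 < p) (r : ℕ) (hr : r ≤ p) (ε : ℝ) (hε : 0 < ε) :
    ∃ δ : ℝ, 0 < δ ∧ ∀ (α : Type) [Fintype α] [DecidableEq α] (G : SimpleGraph α)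
      [DecidableRel G.Adj],
      (#(G.cliqueFinset (p + 1)) : ℝ) ≤ δ * (Fintype.card α : ℝ) ^ (p + 1) →
      (#(G.cliqueFinset r) : ℝ) ≤
        (p.choose r / (p : ℝ) ^ r + ε) * (Fintype.card α : ℝ) ^ r := by
  induction r generalizing ε with
  | zero =>
    refine ⟨1, one_pos, fun α _ _ G _ _ => ?_⟩
    have := G.card_cliqueFinset_le_pow 0
    have h : (#(G.cliqueFinset 0) : ℝ) ≤ 1 := by exact_mod_cast this
    simp only [pow_zero, Nat.choose_zero_right, Nat.cast_one]
    linarith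
  | succ j ih =>
    obtain ⟨δ₁, hδ₁, H₁⟩ := ih (by omega) (ε / 2) (by positivity)
    obtain ⟨δ₂, hδ₂, H₂⟩ := exists_card_cliqueFinset_succ_le p j (by omega) (ε / 2) (by positivity)
    refine ⟨min δ₁ δ₂, lt_min hδ₁ hδ₂, fun α _ _ G _ h => ?_⟩
    have h1 := H₁ α G (h.trans (by gcongr; exact min_le_left _ _))
    have h2 := H₂ α G (h.trans (by gcongr; exact min_le_right _ _))
    set n : ℝ := (Fintype.card α : ℝ)
    have hn : 0 ≤ n := by positivity
    have hp1 : (1 : ℝ) ≤ p := by exact_mod_cast hp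
    have hj0 : (0 : ℝ) ≤ j := j.cast_nonneg
    have hpj : (0 : ℝ) ≤ p - j := by
      rw [sub_nonneg]; exact_mod_cast (by omega : j ≤ p)
    have hch : (p.choose (j + 1) * (j + 1) : ℝ) = p.choose j * (p - j) := by
      have := Nat.choose_succ_right_eq p j
      rw [← Nat.cast_sub (by omega : j ≤ p)]
      exact_mod_cast this
    have hpos : (0 : ℝ) < (j + 1) * p := by positivity
    refine le_of_mul_le_mul_left ?_ hpos
    calc ((j + 1) * p * #(G.cliqueFinset (j + 1)) : ℝ)
        ≤ (p - j) * n * ((p.choose j / (p : ℝ) ^ j + ε / 2) * n ^ j) + ε / 2 * n ^ (j + 1) := by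
          refine h2.trans ?_
          gcongr
      _ = (p.choose j * (p - j)) / (p : ℝ) ^ j * n ^ (j + 1) +
            (p - j) * (ε / 2 * n ^ (j + 1)) + ε / 2 * n ^ (j + 1) := by ring
      _ ≤ (p.choose j * (p - j)) / (p : ℝ) ^ j * n ^ (j + 1) +
            (j + 1) * p * (ε / 2 * n ^ (j + 1)) + (j + 1) * p * (ε / 2 * n ^ (j + 1)) := by
          have hX : 0 ≤ ε / 2 * n ^ (j + 1) := by positivity
          have c1 : (p - j : ℝ) ≤ (j + 1) * p := by nlinarith
          have c2 : (1 : ℝ) ≤ (j + 1) * p := by nlinarith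
          nlinarith [mul_le_mul_of_nonneg_right c1 hX, mul_le_mul_of_nonneg_right c2 hX]
      _ = (j + 1) * p * ((p.choose (j + 1) / (p : ℝ) ^ (j + 1) + ε) * n ^ (j + 1)) := by
          rw [← hch]
          field_simp
          ring

/-! ### Cliques of the Turán graph -/

open Finset in
/-- A `j`-clique of the Turán graph with `s` parts can be extended by any vertex in one of the
`s - j` parts that it misses, and each part has at least `n / s` vertices. -/
lemma mul_div_le_card_commonNbrFinset_turanGraph (n s j : ℕ) (hs : 0 < s) (C : Finset (Fin n))
    (hC : #C = j) : (s - j) * (n / s) ≤ #((turanGraph n s).commonNbrFinset C) := by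
  set D : Finset ℕ := range s \ C.image fun v : Fin n => (v : ℕ) % s
  have hD : s - j ≤ #D := by
    have h1 : #(C.image fun v : Fin n => (v : ℕ) % s) ≤ j := hC ▸ card_image_le
    have h2 := le_card_sdiff (C.image fun v : Fin n => (v : ℕ) % s) (range s)
    rw [card_range] at h2
    exact (Nat.sub_le_sub_left h1 s).trans h2
  calc (s - j) * (n / s) ≤ #(D ×ˢ range (n / s)) := by
        rw [card_product, card_range]
        gcongr
    _ ≤ #(((turanGraph n s).commonNbrFinset C).image fun v : Fin n => (v : ℕ)) := by
        refine card_le_card_of_injOn (fun q => q.1 + s * q.2) ?_ ?_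
        · rintro ⟨c, a⟩ h
          simp only [D, coe_product, Set.mem_prod, mem_coe, mem_sdiff, mem_range, mem_image,
            not_exists, not_and] at h
          obtain ⟨⟨hcs, hc⟩, ha⟩ := h
          have hlt : c + s * a < n := by
            calc c + s * a < s + s * a := by omega
              _ = s * (a + 1) := by ring
              _ ≤ s * (n / s) := by gcongr; omega
              _ ≤ n := Nat.mul_div_le n s
          simp only [coe_image, Set.mem_image, mem_coe, mem_commonNbrFinset]
          refine ⟨⟨c + s * a, hlt⟩, fun v hv => ?_, rfl⟩
          simp only [turanGraph, Nat.add_mul_mod_self_left, Nat.mod_eq_of_lt hcs]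
          exact hc v hv
        · rintro ⟨c, a⟩ h ⟨c', a'⟩ h' heq
          simp only [D, coe_product, Set.mem_prod, mem_coe, mem_sdiff, mem_range] at h h'
          simp only at heq
          have e1 : c = c' := by
            have := congrArg (· % s) heq
            simpa only [Nat.add_mul_mod_self_left, Nat.mod_eq_of_lt h.1.1,
              Nat.mod_eq_of_lt h'.1.1] using this
          subst e1
          have e2 : a = a' := Nat.eq_of_mul_eq_mul_left hs (by omega)
          rw [e2]
    _ ≤ _ := card_image_le

open Finset in
lemma choose_mul_div_pow_le_card_cliqueFinset_turanGraph (n s j : ℕ) (hs : 0 < s) :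
    s.choose j * (n / s) ^ j ≤ #((turanGraph n s).cliqueFinset j) := by
  induction j with
  | zero =>
    rw [pow_zero, Nat.choose_zero_right, mul_one, Nat.one_le_iff_ne_zero]
    exact card_ne_zero_of_mem (a := ∅) (by simp [mem_cliqueFinset_iff, isNClique_iff])
  | succ j ih =>
    refine le_of_mul_le_mul_left ?_ (Nat.succ_pos j)
    calc (j + 1) * (s.choose (j + 1) * (n / s) ^ (j + 1))
        = s.choose j * (n / s) ^ j * ((s - j) * (n / s)) := by
          rw [pow_succ, ← mul_assoc, mul_comm (j + 1), Nat.choose_succ_right_eq]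
          ring
      _ ≤ #((turanGraph n s).cliqueFinset j) * ((s - j) * (n / s)) := by gcongr
      _ ≤ ∑ C ∈ (turanGraph n s).cliqueFinset j, #((turanGraph n s).commonNbrFinset C) := by
          rw [← smul_eq_mul]
          exact card_nsmul_le_sum _ _ _ fun C hC =>
            mul_div_le_card_commonNbrFinset_turanGraph n s j hs C
              (((turanGraph n s).mem_cliqueFinset_iff).1 hC).2
      _ = _ := sum_card_commonNbrFinset _ j

end SimpleGraph

/-! ### Complete multipartite patterns in dense relations -/

section Box

open Finset

lemma card_filter_apply_eq_le {α : Type*} [Fintype α] [DecidableEq α] {t : ℕ} (i j : Fin (t + 1))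
    (hij : i ≠ j) :
    #{τ : Fin (t + 1) → α | τ i = τ j} ≤ Fintype.card α ^ t := by
  calc _ ≤ #(univ : Finset (Fin t → α)) := by
        refine card_le_card_of_injOn (fun τ => τ ∘ j.succAbove) (fun _ _ => by simp) ?_
        intro τ hτ σ hσ h
        simp only [coe_filter, mem_univ, true_and, Set.mem_ofPred_eq] at hτ hσ
        have h' (k : Fin (t + 1)) (hk : k ≠ j) : τ k = σ k := by
          obtain ⟨l, rfl⟩ := Fin.exists_succAbove_eq hk
          exact congrFun h l
        funext k
        by_cases hk : k = j
        · rw [hk, ← hτ, ← hσ, h' i hij]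
        · exact h' k hk
    _ = _ := by simp

lemma card_filter_not_injective_le {α : Type*} [Fintype α] [DecidableEq α] (t : ℕ) :
    #{τ : Fin (t + 1) → α | ¬ Function.Injective τ} ≤ (t + 1) ^ 2 * Fintype.card α ^ t := by
  calc _ ≤ #((univ : Finset (Fin (t + 1))).offDiag.biUnion fun q =>
            ({τ : Fin (t + 1) → α | τ q.1 = τ q.2} : Finset _)) := by
        refine card_le_card fun τ hτ => ?_
        simp only [mem_filter, mem_univ, true_and, Function.Injective, not_forall] at hτ
        obtain ⟨i, j, h, hij⟩ := hτ
        simp only [mem_biUnion, mem_offDiag, mem_univ, true_and, mem_filter]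
        exact ⟨(i, j), hij, h⟩
    _ ≤ #(univ : Finset (Fin (t + 1))).offDiag * Fintype.card α ^ t := by
        refine card_biUnion_le_card_mul _ _ _ fun q hq => ?_
        exact card_filter_apply_eq_le q.1 q.2 (mem_offDiag.1 hq).2.2
    _ ≤ _ := by
        gcongr
        rw [offDiag_card]
        simp only [card_univ, Fintype.card_fin, sq]
        exact Nat.sub_le _ _

/-- Counting the pairs of a point `y` and a `(t + 1)`-tuple of first coordinates that extend `y`
into `R`; the bound is the power mean inequality. -/
lemma pow_card_le_sum_card_filter_forall_cons {α : Type*} [Fintype α] [DecidableEq α] (m t : ℕ)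
    (R : Finset (Fin (m + 1) → α)) :
    (#R : ℝ) ^ (t + 1) ≤ ((Fintype.card α : ℝ) ^ m) ^ t *
      ∑ τ : Fin (t + 1) → α,
        (#{y : Fin m → α | ∀ i, (Fin.cons (τ i) y : Fin (m + 1) → α) ∈ R} : ℝ) := by
  set D : (Fin m → α) → Finset α := fun y => {v | (Fin.cons v y : Fin (m + 1) → α) ∈ R}
  have h1 : #R = ∑ y : Fin m → α, #(D y) := by
    rw [card_eq_sum_card_fiberwise (f := Fin.tail) (t := univ) (fun _ _ => by simp)]
    refine Finset.sum_congr rfl fun y _ => ?_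
    refine card_bij' (fun z _ => z 0) (fun v _ => Fin.cons v y) ?_ ?_ ?_ ?_
    · intro z hz
      simp only [mem_filter] at hz
      simp only [D, mem_filter, mem_univ, true_and]
      rw [← hz.2, Fin.cons_self_tail]
      exact hz.1
    · intro v hv
      simp only [D, mem_filter, mem_univ, true_and] at hv
      simp [hv]
    · intro z hz
      simp only [mem_filter] at hz
      rw [← hz.2, Fin.cons_self_tail]
    · intro v _
      simp
  have h2 : ∑ τ : Fin (t + 1) → α,
      #{y : Fin m → α | ∀ i, (Fin.cons (τ i) y : Fin (m + 1) → α) ∈ R} =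
      ∑ y : Fin m → α, #(D y) ^ (t + 1) := by
    simp only [card_filter]
    rw [Finset.sum_comm]
    refine Finset.sum_congr rfl fun y _ => ?_
    rw [← card_filter, ← Fintype.card_piFinset_const]
    congr 1
    ext τ
    simp [D, Fintype.mem_piFinset]
  have h3 := pow_sum_div_card_le_sum_pow (s := (univ : Finset (Fin m → α)))
    (f := fun y => (#(D y) : ℝ)) (fun _ _ => by positivity) t
  have h1' : (#R : ℝ) = ∑ y : Fin m → α, (#(D y) : ℝ) := by exact_mod_cast h1
  have h2' : ∑ τ : Fin (t + 1) → α,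
      (#{y : Fin m → α | ∀ i, (Fin.cons (τ i) y : Fin (m + 1) → α) ∈ R} : ℝ) =
      ∑ y : Fin m → α, (#(D y) : ℝ) ^ (t + 1) := by exact_mod_cast h2
  rw [h1', h2']
  rcases isEmpty_or_nonempty (Fin m → α) with he | hne
  · simp
  · have hc : (0 : ℝ) < ((Fintype.card α : ℝ) ^ m) ^ t := by
      have : (Fintype.card α : ℝ) ^ m = (Fintype.card (Fin m → α) : ℝ) := by simp
      rw [this]
      have := Fintype.card_pos (α := Fin m → α)
      positivity
    rw [card_univ, Fintype.card_fun, Fintype.card_fin, Nat.cast_pow, div_le_iff₀ hc] at h3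
    rw [mul_comm]
    exact h3

/-- **Erdős's theorem on multipartite hypergraphs**: a dense `m`-ary relation on a large set
contains a product of `m` sets of any prescribed size. The sets are given as ranges of injective
tuples `x i`. -/
theorem exists_box_of_dense (t m : ℕ) (δ : ℝ) (hδ : 0 < δ) :
    ∃ N : ℕ, ∀ (α : Type) [Fintype α], N ≤ Fintype.card α →
      ∀ R : Finset (Fin m → α), δ * (Fintype.card α : ℝ) ^ m ≤ #R →
        ∃ x : Fin m → Fin (t + 1) → α, (∀ i, Function.Injective (x i)) ∧
          ∀ g : Fin m → Fin (t + 1), (fun i => x i (g i)) ∈ R := by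
  induction m generalizing δ with
  | zero =>
    refine ⟨0, fun α _ _ R hR => ⟨fun i => i.elim0, fun i => i.elim0, fun g => ?_⟩⟩
    have hpos : 0 < #R := by
      have : (0 : ℝ) < #R := hδ.trans_le (by simpa using hR)
      exact_mod_cast this
    obtain ⟨y, hy⟩ := card_pos.1 hpos
    rwa [Subsingleton.elim (fun i => _) y]
  | succ m ih =>
    obtain ⟨N, hN⟩ := ih (δ ^ (t + 1) / 2) (by positivity)
    obtain ⟨M, hM⟩ := exists_nat_gt (2 * (t + 1) ^ 2 / δ ^ (t + 1))
    refine ⟨max N M, fun α _ hα R hR => ?_⟩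
    classical
    set n : ℝ := (Fintype.card α : ℝ) with hn
    have hMn : 2 * (t + 1) ^ 2 / δ ^ (t + 1) < n :=
      hM.trans_le (by rw [hn]; exact_mod_cast (le_max_right _ _).trans hα)
    have hn0 : 0 < n := lt_of_le_of_lt (by positivity) hMn
    set Rτ : (Fin (t + 1) → α) → Finset (Fin m → α) := fun τ =>
      {y | ∀ i, (Fin.cons (τ i) y : Fin (m + 1) → α) ∈ R}
    -- some injective tuple `τ` of first coordinates has a dense link
    have hτ : ∃ τ : Fin (t + 1) → α, Function.Injective τ ∧
        δ ^ (t + 1) / 2 * n ^ m ≤ #(Rτ τ) := by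
      by_contra! hcon
      have hsum := pow_card_le_sum_card_filter_forall_cons m t R
      have hle (τ : Fin (t + 1) → α) : (#(Rτ τ) : ℝ) ≤ δ ^ (t + 1) / 2 * n ^ m +
          if ¬ Function.Injective τ then n ^ m else 0 := by
        by_cases h : Function.Injective τ
        · simpa [h] using (hcon τ h).le
        · have h1 : (#(Rτ τ) : ℝ) ≤ n ^ m := by
            have := card_le_univ (Rτ τ)
            rw [Fintype.card_fun, Fintype.card_fin] at this
            rw [hn]
            exact_mod_cast this
          have h2 : 0 ≤ δ ^ (t + 1) / 2 * n ^ m := by positivity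
          simp only [h, not_false_eq_true, if_true]
          linarith
      have hbad : (#{τ : Fin (t + 1) → α | ¬ Function.Injective τ} : ℝ) ≤ (t + 1) ^ 2 * n ^ t := by
        rw [hn]
        exact_mod_cast card_filter_not_injective_le (α := α) t
      have hup : ∑ τ : Fin (t + 1) → α, (#(Rτ τ) : ℝ) ≤
          n ^ (t + 1) * (δ ^ (t + 1) / 2 * n ^ m) + (t + 1) ^ 2 * n ^ t * n ^ m := by
        refine (Finset.sum_le_sum fun τ _ => hle τ).trans ?_
        rw [sum_add_distrib, ← sum_filter, sum_const, sum_const, nsmul_eq_mul, nsmul_eq_mul,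
          card_univ, Fintype.card_fun, Fintype.card_fin]
        push_cast
        rw [← hn]
        gcongr
      have hlow : (δ * n ^ (m + 1)) ^ (t + 1) ≤ (#R : ℝ) ^ (t + 1) := by gcongr
      have hstrict : (t + 1) ^ 2 * n ^ t * n ^ m < n ^ (t + 1) * (δ ^ (t + 1) / 2 * n ^ m) := by
        rw [div_lt_iff₀ (by positivity)] at hMn
        have : 0 < n ^ t * n ^ m := by positivity
        have := mul_lt_mul_of_pos_right hMn this
        rw [pow_succ n t]
        linarith
      have : (δ * n ^ (m + 1)) ^ (t + 1) < (n ^ m) ^ t * (n ^ (t + 1) * (δ ^ (t + 1) * n ^ m)) := by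
        refine (hlow.trans hsum).trans_lt ?_
        refine mul_lt_mul_of_pos_left ?_ (by positivity)
        linarith
      refine this.ne ?_
      ring
    obtain ⟨τ, hinj, hdense⟩ := hτ
    obtain ⟨x, hx, hbox⟩ := hN α ((le_max_left _ _).trans hα) (Rτ τ) hdense
    refine ⟨Fin.cons τ x, fun i => ?_, fun g => ?_⟩
    · refine Fin.cases ?_ (fun i => ?_) i
      · simpa using hinj
      · simpa using hx i
    · have h := hbox fun i => g i.succ
      simp only [Rτ, mem_filter, mem_univ, true_and] at h
      convert h (g 0) using 1
      funext i
      refine Fin.cases ?_ (fun i => ?_) i <;> simp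

end Box

/-! ### Graphs without a copy of an `m`-colourable graph -/

namespace SimpleGraph

open Finset

lemma card_cliqueFinset_le_card_filter_pairwise {α : Type*} [Fintype α] [DecidableEq α]
    (G : SimpleGraph α) [DecidableRel G.Adj] (m : ℕ) :
    #(G.cliqueFinset m) ≤ #{x : Fin m → α | ∀ i j, i ≠ j → G.Adj (x i) (x j)} := by
  refine le_trans (card_le_card (t := image (fun x : Fin m → α => univ.image x) _) ?_)
    card_image_le
  intro A hA
  rw [mem_cliqueFinset_iff] at hA
  let e := A.equivFinOfCardEq hA.2
  simp only [mem_image, mem_filter, mem_univ, true_and]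
  refine ⟨fun i => e.symm i, fun i j hij => ?_, ?_⟩
  · exact hA.1 (e.symm i).2 (e.symm j).2 fun h => hij (e.symm.injective (Subtype.ext h))
  · ext v
    simp only [mem_image, mem_univ, true_and]
    constructor
    · rintro ⟨i, rfl⟩
      exact (e.symm i).2
    · intro hv
      exact ⟨e ⟨v, hv⟩, by simp⟩

/-- A large graph with no copy of an `m`-colourable graph has few `m`-cliques, since the blow-up of
an `m`-clique contains the `m`-colourable graph. -/
lemma exists_card_cliqueFinset_le_of_free {V : Type*} [Finite V] (F : SimpleGraph V) (m : ℕ)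
    (hF : F.Colorable m) (δ : ℝ) (hδ : 0 < δ) :
    ∃ N : ℕ, ∀ (α : Type) [Fintype α] [DecidableEq α] (G : SimpleGraph α) [DecidableRel G.Adj],
      N ≤ Fintype.card α → F.Free G →
        (#(G.cliqueFinset m) : ℝ) ≤ δ * (Fintype.card α : ℝ) ^ m := by
  obtain ⟨N, hN⟩ := exists_box_of_dense (Nat.card V) m δ hδ
  refine ⟨N, fun α _ _ G _ hα hfree => ?_⟩
  by_contra! hcon
  obtain ⟨x, hinj, hbox⟩ := hN α hα
    {x : Fin m → α | ∀ i j, i ≠ j → G.Adj (x i) (x j)}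
    (hcon.le.trans (by exact_mod_cast G.card_cliqueFinset_le_card_filter_pairwise m))
  obtain ⟨c⟩ := hF
  let e : V → Fin (Nat.card V + 1) := fun v => (Finite.equivFin V v).castSucc
  have he : Function.Injective e :=
    (Fin.castSucc_injective _).comp (Finite.equivFin V).injective
  have hadj (u v : V) (huv : c u ≠ c v) : G.Adj (x (c u) (e u)) (x (c v) (e v)) := by
    have h := hbox (Function.update (fun _ => e v) (c u) (e u))
    simp only [mem_filter, mem_univ, true_and] at h
    simpa [Function.update_of_ne huv.symm] using h (c u) (c v) huv
  refine hfree ⟨⟨⟨fun v => x (c v) (e v), fun {u v} huv => hadj u v (c.valid huv)⟩, ?_⟩⟩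
  intro u v huv
  simp only [RelHom.coeFn_mk] at huv
  by_cases h : c u = c v
  · rw [h] at huv
    exact he (hinj _ huv)
  · exact absurd huv (hadj u v h).ne

/-- The asymptotic generalised Turán theorem: a large graph with no copy of a `(p + 1)`-colourable
graph has at most about as many `r`-cliques as the Turán graph with `p` parts. -/
theorem exists_card_cliqueFinset_le_of_free_of_colorable {V : Type*} [Finite V]
    (F : SimpleGraph V) (p : ℕ) (hp : 0 < p) (hF : F.Colorable (p + 1)) (r : ℕ) (hr : r ≤ p)
    (ε : ℝ) (hε : 0 < ε) :
    ∃ N : ℕ, ∀ (α : Type) [Fintype α] [DecidableEq α] (G : SimpleGraph α) [DecidableRel G.Adj],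
      N ≤ Fintype.card α → F.Free G →
        (#(G.cliqueFinset r) : ℝ) ≤
          (p.choose r / (p : ℝ) ^ r + ε) * (Fintype.card α : ℝ) ^ r := by
  obtain ⟨δ, hδ, H⟩ := exists_card_cliqueFinset_le p hp r hr ε hε
  obtain ⟨N, hN⟩ := exists_card_cliqueFinset_le_of_free F (p + 1) hF δ hδ
  exact ⟨N, fun α _ _ G _ hα hfree => H α G (hN α G hα hfree)⟩

end SimpleGraph

namespace BergeHypergraph

open Finset

/-! ### Robust pairs of an `r`-uniform family -/

/-- The pairs `u, v` that are robustly covered by the family `E`: after forbidding any `L` vertices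
other than `u` and `v`, some member of `E` still contains both. -/
def robustGraph {α : Type*} (E : Finset (Finset α)) (L : ℕ) : SimpleGraph α where
  Adj u v := u ≠ v ∧ ∀ B : Finset α, #B ≤ L → u ∉ B → v ∉ B →
    ∃ e ∈ E, u ∈ e ∧ v ∈ e ∧ Disjoint e B
  symm := ⟨fun _ _ h => ⟨h.1.symm, fun B hB hu hv =>
    let ⟨e, he, h1, h2, h3⟩ := h.2 B hB hv hu
    ⟨e, he, h2, h1, h3⟩⟩⟩
  loopless := ⟨fun _ h => h.1 rfl⟩

section Counting

variable {α : Type*} [Fintype α] [DecidableEq α]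

lemma card_filter_subset_le (E : Finset (Finset α)) (r : ℕ) (hE : ∀ e ∈ E, #e = r)
    (T : Finset α) : #{e ∈ E | T ⊆ e} ≤ Fintype.card α ^ (r - #T) := by
  calc _ ≤ #(powersetCard (r - #T) (univ : Finset α)) := by
        refine card_le_card_of_injOn (fun e => e \ T) ?_ ?_
        · intro e he
          simp only [coe_filter, Set.mem_ofPred_eq] at he
          simp [card_sdiff_of_subset he.2, hE e he.1]
        · intro e he e' he' h
          simp only [coe_filter, Set.mem_ofPred_eq] at he he'
          simp only at h
          rw [← sdiff_union_of_subset he.2, h, sdiff_union_of_subset he'.2]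
    _ ≤ _ := by
        rw [card_powersetCard, card_univ]
        exact Nat.choose_le_pow _ _

/-- A pair that is not robust is contained in few members of `E`, as they all meet one small set. -/
lemma card_filter_mem_mem_le (E : Finset (Finset α)) (r L : ℕ) (hE : ∀ e ∈ E, #e = r) (u v : α)
    (huv : u ≠ v) (h : ¬ (robustGraph E L).Adj u v) :
    #{e ∈ E | u ∈ e ∧ v ∈ e} ≤ L * Fintype.card α ^ (r - 3) := by
  simp only [robustGraph, ne_eq, huv, not_false_eq_true, true_and, not_forall] at h
  obtain ⟨B, hB, hu, hv, h⟩ := h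
  push Not at h
  calc _ ≤ #(B.biUnion fun w => {e ∈ E | ({u, v, w} : Finset α) ⊆ e}) := by
        refine card_le_card fun e he => ?_
        simp only [mem_filter] at he
        obtain ⟨w, hwe, hwB⟩ := not_disjoint_iff.1 (h e he.1 he.2.1 he.2.2)
        simp only [mem_biUnion, mem_filter]
        refine ⟨w, hwB, he.1, ?_⟩
        simp [insert_subset_iff, he.2.1, he.2.2, hwe]
    _ ≤ #B * Fintype.card α ^ (r - 3) := by
        refine card_biUnion_le_card_mul _ _ _ fun w hw => ?_
        have hT : #({u, v, w} : Finset α) = 3 :=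
          card_eq_three.2 ⟨u, v, w, huv, fun e => hu (e ▸ hw), fun e => hv (e ▸ hw), rfl⟩
        have := card_filter_subset_le E r hE {u, v, w}
        rwa [hT] at this
    _ ≤ _ := by gcongr

/-- All but `O(n ^ (r - 1))` members of `E` are cliques of robust pairs. -/
lemma card_le_card_cliqueFinset_robustGraph_add (E : Finset (Finset α)) (r L : ℕ) (hr : 3 ≤ r)
    (hE : ∀ e ∈ E, #e = r) [DecidableRel (robustGraph E L).Adj] :
    #E ≤ #((robustGraph E L).cliqueFinset r) + L * Fintype.card α ^ (r - 1) := by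
  set P : Finset (α × α) := {q | q.1 ≠ q.2 ∧ ¬ (robustGraph E L).Adj q.1 q.2}
  calc #E ≤ #((robustGraph E L).cliqueFinset r ∪
          P.biUnion fun q => {e ∈ E | q.1 ∈ e ∧ q.2 ∈ e}) := by
        refine card_le_card fun e he => ?_
        rw [mem_union]
        by_cases hcl : (robustGraph E L).IsClique (e : Set α)
        · exact Or.inl (SimpleGraph.mem_cliqueFinset_iff.2 ⟨hcl, hE e he⟩)
        · right
          rw [SimpleGraph.isClique_iff, Set.Pairwise] at hcl
          push Not at hcl
          obtain ⟨u, hu, v, hv, huv, h⟩ := hcl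
          simp only [P, mem_biUnion, mem_filter, mem_univ, true_and]
          exact ⟨(u, v), ⟨huv, h⟩, he, hu, hv⟩
    _ ≤ #((robustGraph E L).cliqueFinset r) + #P * (L * Fintype.card α ^ (r - 3)) := by
        refine (card_union_le _ _).trans (Nat.add_le_add_left ?_ _)
        refine card_biUnion_le_card_mul _ _ _ fun q hq => ?_
        simp only [P, mem_filter, mem_univ, true_and] at hq
        exact card_filter_mem_mem_le E r L hE q.1 q.2 hq.1 hq.2
    _ ≤ #((robustGraph E L).cliqueFinset r) +
          Fintype.card α ^ 2 * (L * Fintype.card α ^ (r - 3)) := by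
        gcongr
        refine (card_le_univ P).trans ?_
        rw [Fintype.card_prod, sq]
    _ = _ := by
        obtain ⟨q, rfl⟩ := Nat.exists_eq_add_of_le hr
        rw [show 3 + q - 3 = q by omega, show 3 + q - 1 = q + 2 by omega]
        ring

end Counting

/-! ### Berge copies of expansions from robust pairs -/

section Embedding

variable {V α : Type*} [Fintype V] [DecidableEq α] {F : SimpleGraph V}

/-- Greedy choice: the edges of a copy of `F` in the robust graph can be covered by members of the
family that meet each other and the copy only where they have to. -/
lemma exists_cover_of_copy (E : Finset (Finset α)) (r L : ℕ)
    (hE : ∀ e ∈ E, #e = r) (ψ : SimpleGraph.Copy F (robustGraph E L)) (S : Finset F.edgeSet)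
    (hL : Fintype.card V + #S * r ≤ L) :
    ∃ g : F.edgeSet → Finset α, (∀ e ∈ S, g e ∈ E) ∧
      (∀ e ∈ S, ∀ v, ψ v ∈ g e ↔ v ∈ (e : Sym2 V)) ∧
      ∀ e ∈ S, ∀ e' ∈ S, e ≠ e' → ∀ x ∈ g e, x ∈ g e' → x ∈ Set.range ψ := by
  classical
  induction S using Finset.induction_on with
  | empty => exact ⟨fun _ => ∅, by simp⟩
  | insert e₀ S he₀ ih =>
    rw [card_insert_of_notMem he₀] at hL
    obtain ⟨g, hgE, hgv, hgd⟩ := ih (by nlinarith)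
    obtain ⟨e, hF⟩ := e₀
    induction e using Sym2.ind with | _ u v
    have huv : (robustGraph E L).Adj (ψ u) (ψ v) := ψ.toHom.map_adj hF
    set B : Finset α := (univ.image ψ ∪ S.biUnion g) \ {ψ u, ψ v} with hBdef
    have hB : #B ≤ L := by
      calc #B ≤ #(univ.image ψ ∪ S.biUnion g) := card_le_card sdiff_subset
        _ ≤ #(univ.image ψ) + #(S.biUnion g) := card_union_le _ _
        _ ≤ Fintype.card V + #S * r :=
          Nat.add_le_add card_image_le
            (card_biUnion_le_card_mul _ _ _ fun e he => (hE _ (hgE e he)).le)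
        _ ≤ L := by nlinarith
    obtain ⟨e₁, he₁, hu, hv, hdis⟩ := huv.2 B hB (by simp [hBdef]) (by simp [hBdef])
    have hmem (x : α) (hx : x ∈ e₁) (hx' : x ∈ univ.image ψ ∪ S.biUnion g) :
        x = ψ u ∨ x = ψ v := by
      by_contra h
      refine disjoint_left.1 hdis hx ?_
      rw [hBdef, mem_sdiff]
      exact ⟨hx', by simpa using h⟩
    have hrange (x : α) (hx : x ∈ e₁) (hx' : x ∈ S.biUnion g) : x ∈ Set.range ψ := by
      rcases hmem x hx (mem_union_right _ hx') with rfl | rfl <;> exact Set.mem_range_self _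
    have hne (e : F.edgeSet) (he : e ∈ S) : e ≠ ⟨s(u, v), hF⟩ := fun h => he₀ (h ▸ he)
    refine ⟨Function.update g ⟨s(u, v), hF⟩ e₁, ?_, ?_, ?_⟩
    · intro e he
      rcases mem_insert.1 he with rfl | he
      · simpa using he₁
      · simpa [hne e he] using hgE e he
    · intro e he w
      rcases mem_insert.1 he with rfl | he
      · simp only [Function.update_self, Sym2.mem_iff]
        constructor
        · intro hw
          exact (hmem _ hw (mem_union_left _ (by simp))).imp (fun h => ψ.injective h)
            (fun h => ψ.injective h)
        · rintro (rfl | rfl) <;> assumption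
      · simpa [hne e he] using hgv e he w
    · intro e he e' he' hee x hx hx'
      rcases mem_insert.1 he with rfl | he <;> rcases mem_insert.1 he' with rfl | he'
      · exact absurd rfl hee
      · rw [Function.update_self] at hx
        rw [Function.update_of_ne (hne e' he')] at hx'
        exact hrange x hx (mem_biUnion.2 ⟨e', he', hx'⟩)
      · rw [Function.update_self] at hx'
        rw [Function.update_of_ne (hne e he)] at hx
        exact hrange x hx' (mem_biUnion.2 ⟨e, he, hx⟩)
      · rw [Function.update_of_ne (hne e he)] at hx
        rw [Function.update_of_ne (hne e' he')] at hx'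
        exact hgd e he e' he' hee x hx hx'

/-- A copy of `F` in the robust graph yields an `r`-uniform Berge copy of the expansion of `F`. -/
lemma exists_bergeCopy_of_copy (E : Finset (Finset α)) (k r L : ℕ) (hkr : k ≤ r)
    (hE : ∀ e ∈ E, #e = r) (hL : Fintype.card V + Nat.card F.edgeSet * r ≤ L)
    (hF : F.IsContained (robustGraph E L)) :
    ∃ H' : Hypergraph α, IsUniform H' r ∧ IsBergeCopy (expansion F k) H' ∧
      ∀ e ∈ H'.edgeSet, ∃ e' ∈ E, (e' : Set α) = e := by
  classical
  obtain ⟨ψ⟩ := hF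
  obtain ⟨g, hgE, hgv, hgd⟩ := exists_cover_of_copy E r L hE ψ univ
    (by rwa [card_univ, ← Nat.card_eq_fintype_card (α := F.edgeSet)])
  simp only [mem_univ, true_implies] at hgE hgv hgd
  -- the members `g e` have enough vertices outside the copy for the expansion vertices
  have hnew (e : F.edgeSet) : ∃ ι : Fin (k - 2) → α, Function.Injective ι ∧
      ∀ i, ι i ∈ g e ∧ ι i ∉ Set.range ψ := by
    have hcard : k - 2 ≤ #(g e \ univ.image ψ) := by
      have h2 : #(univ.image ψ ∩ g e) ≤ 2 := by
        obtain ⟨e, he⟩ := e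
        induction e using Sym2.ind with | _ u v
        refine (card_le_card (t := {ψ u, ψ v}) fun x hx => ?_).trans card_le_two
        simp only [mem_inter, mem_image, mem_univ, true_and] at hx
        obtain ⟨⟨w, rfl⟩, hw⟩ := hx
        rw [hgv, Sym2.mem_iff] at hw
        rcases hw with rfl | rfl <;> simp
      have := hE _ (hgE e)
      rw [card_sdiff]
      omega
    obtain ⟨T, hT, hTc⟩ := exists_subset_card_eq hcard
    let b := T.equivFinOfCardEq hTc
    refine ⟨fun i => b.symm i, fun i j h => b.symm.injective (Subtype.ext h), fun i => ?_⟩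
    have := hT (b.symm i).2
    simpa using this
  choose ι hι hιg using hnew
  let φ : V ⊕ (F.edgeSet × Fin (k - 2)) → α := Sum.elim ψ fun p => ι p.1 p.2
  have hφ : Function.Injective φ := by
    rintro (v | ⟨e, i⟩) (w | ⟨e', i'⟩) h
    · exact congrArg _ (ψ.injective h)
    · exact absurd ⟨v, h⟩ (hιg e' i').2
    · exact absurd ⟨w, h.symm⟩ (hιg e i).2
    · have h' : ι e i = ι e' i' := h
      by_cases hee : e = e'
      · subst hee
        rw [hι e h']
      · exact absurd (hgd e e' hee _ (hιg e i).1 (h' ▸ (hιg e' i').1)) (hιg e i).2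
  set a : F.edgeSet → Set (V ⊕ (F.edgeSet × Fin (k - 2))) := fun e =>
    Sum.inl '' {v | v ∈ (e : Sym2 V)} ∪ Sum.inr '' {p | p.1 = e}
  have ha : Function.Injective a := by
    intro e e' h
    refine Subtype.ext (Sym2.ext fun v => ?_)
    have := Set.ext_iff.1 h (Sum.inl v)
    simpa [a] using this
  have hb : Function.Injective fun e => (g e : Set α) := by
    intro e e' h
    refine Subtype.ext (Sym2.ext fun v => ?_)
    rw [← hgv e v, ← hgv e' v, coe_injective h]
  let H' : Hypergraph α :=
    ⟨Set.univ, Set.range fun e => (g e : Set α), fun _ _ => Set.subset_univ _⟩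
  let fF : F.edgeSet ≃ (expansion F k).edgeSet := Equiv.ofInjective a ha
  let fH : F.edgeSet ≃ H'.edgeSet := Equiv.ofInjective _ hb
  refine ⟨H', ?_, ⟨⟨fun v => ⟨φ v, Set.mem_univ _⟩, fun v w h => ?_⟩, fF.symm.trans fH, ?_⟩, ?_⟩
  · rintro _ ⟨e, rfl⟩
    simp only [Set.encard_coe_eq_coe_finsetCard, hE _ (hgE e)]
  · exact Subtype.ext (hφ (congrArg Subtype.val h))
  · rintro h ⟨v, hV⟩ hv
    obtain ⟨e, rfl⟩ := fF.surjective h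
    have he : (fF.symm.trans fH) (fF e) = fH e := by simp
    rw [he]
    change φ v ∈ g e
    rcases hv with ⟨w, hw, rfl⟩ | ⟨p, hp, rfl⟩
    · exact (hgv e w).2 hw
    · obtain rfl : p.1 = e := hp
      exact (hιg p.1 p.2).1
  · rintro _ ⟨e, rfl⟩
    exact ⟨g e, hgE e, rfl⟩

end Embedding

/-! ### The Turán hypergraph -/

lemma ncard_edgeSet_turanHypergraph (r n s : ℕ) (hs : 0 < s) :
    (turanHypergraph r n s).edgeSet.ncard = #((SimpleGraph.turanGraph n s).cliqueFinset r) := by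
  have h : (turanHypergraph r n s).edgeSet =
      (fun e : Finset (Fin n) => (e : Set (Fin n))) ''
        ((SimpleGraph.turanGraph n s).cliqueFinset r : Set (Finset (Fin n))) := by
    ext e
    simp only [turanHypergraph, Set.mem_ofPred_eq, Set.mem_image, mem_coe,
      SimpleGraph.mem_cliqueFinset_iff, SimpleGraph.isNClique_iff]
    constructor
    · rintro ⟨hc, hsub⟩
      refine ⟨e.toFinite.toFinset, ⟨?_, ?_⟩, by simp⟩
      · intro v hv w hw hvw h
        simp only [Set.Finite.coe_toFinset] at hv hw
        exact hvw (hsub ((w : ℕ) % s) (Nat.mod_lt _ hs) ⟨hv, h⟩ ⟨hw, rfl⟩)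
      · rw [e.toFinite.encard_eq_coe_toFinset_card] at hc
        exact_mod_cast hc
    · rintro ⟨e, ⟨hcl, hc⟩, rfl⟩
      refine ⟨by rw [Set.encard_coe_eq_coe_finsetCard, hc], fun j _ v hv w hw => ?_⟩
      by_contra hvw
      exact hcl hv.1 hw.1 hvw (hv.2.trans hw.2.symm)
  rw [h, Set.ncard_image_of_injective _ coe_injective, Set.ncard_coe_finset]

/-- The residues modulo `s` of a Berge copy in the Turán hypergraph colour the graph. -/
lemma colorable_of_bergeCopy_turanHypergraph {V : Type*} (F : SimpleGraph V) (k r n s : ℕ)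
    (hs : 0 < s) (H' : Hypergraph (Fin n)) (hH' : IsBergeCopy (expansion F k) H')
    (hsub : IsSubhypergraph H' (turanHypergraph r n s)) : F.Colorable s := by
  obtain ⟨φ, f, hf⟩ := hH'
  refine ⟨SimpleGraph.Coloring.mk
    (fun v => ⟨(φ ⟨Sum.inl v, Set.mem_univ _⟩ : Fin n) % s, Nat.mod_lt _ hs⟩) ?_⟩
  intro u v huv heq
  rw [Fin.mk.injEq] at heq
  let h : (expansion F k).edgeSet := ⟨_, ⟨⟨s(u, v), huv⟩, rfl⟩⟩
  have hu := hf h ⟨Sum.inl u, Set.mem_univ _⟩ (Or.inl ⟨u, by simp, rfl⟩)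
  have hv := hf h ⟨Sum.inl v, Set.mem_univ _⟩ (Or.inl ⟨v, by simp, rfl⟩)
  have hT := hsub.2 (f h).2
  have := hT.2 _ (Nat.mod_lt _ hs) ⟨hu, heq⟩ ⟨hv, rfl⟩
  have := φ.injective (Subtype.ext this)
  exact huv.ne (Sum.inl_injective (congrArg Subtype.val this))

/-! ### Bounds for the extremal number -/

lemma ncard_le_ex {r n : ℕ} {C : Set (Hypergraph (Fin n))} (H : Hypergraph (Fin n))
    (hV : H.vertexSet = Set.univ) (hU : IsUniform H r) (hC : ∀ H' ∈ C, ¬ IsSubhypergraph H' H) :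
    H.edgeSet.ncard ≤ ex r n C := by
  refine le_csSup ⟨Nat.card (Set (Fin n)), ?_⟩ ⟨H, hV, hU, hC, rfl⟩
  rintro _ ⟨H, -, -, -, rfl⟩
  exact Set.ncard_le_card H.edgeSet

lemma ex_le {r n : ℕ} {C : Set (Hypergraph (Fin n))} (N : ℕ)
    (h : ∀ H : Hypergraph (Fin n), H.vertexSet = Set.univ → IsUniform H r →
      (∀ H' ∈ C, ¬ IsSubhypergraph H' H) → H.edgeSet.ncard ≤ N) : ex r n C ≤ N := by
  refine csSup_le' ?_
  rintro _ ⟨H, hV, hU, hC, rfl⟩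
  exact h H hV hU hC

lemma ncard_turanHypergraph_le_ex {V : Type*} (F : SimpleGraph V) (k r n s : ℕ) (hs : 0 < s)
    (hF : ¬ F.Colorable s) :
    (turanHypergraph r n s).edgeSet.ncard ≤ ex r n (bergeFamily r (expansion F k) (Fin n)) :=
  ncard_le_ex _ rfl (fun _ he => he.1) fun H' hH' hsub =>
    hF (colorable_of_bergeCopy_turanHypergraph F k r n s hs H' hH'.2 hsub)

/-- The extremal number is at most the maximal number of `r`-cliques in a graph with no copy of
`F`, up to `O(n ^ (r - 1))`. -/
lemma exists_ex_le {V : Type*} [Finite V] (F : SimpleGraph V) (k r : ℕ) (hr : 3 ≤ r)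
    (hkr : k ≤ r) :
    ∃ L : ℕ, ∀ n N : ℕ, (∀ (G : SimpleGraph (Fin n)) [DecidableRel G.Adj], F.Free G →
        #(G.cliqueFinset r) ≤ N) →
      ex r n (bergeFamily r (expansion F k) (Fin n)) ≤ N + L * n ^ (r - 1) := by
  classical
  have := Fintype.ofFinite V
  -- the greedy choice has to avoid a copy of `F` and at most `r` vertices for each of its edges
  refine ⟨Fintype.card V + Nat.card F.edgeSet * r, fun n N hN => ex_le _ fun H hV hU hC => ?_⟩
  set L := Fintype.card V + Nat.card F.edgeSet * r
  set E : Finset (Finset (Fin n)) := {e | (e : Set (Fin n)) ∈ H.edgeSet}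
  have hE : ∀ e ∈ E, #e = r := by
    intro e he
    have := hU e (by simpa [E] using he)
    rw [Set.encard_coe_eq_coe_finsetCard] at this
    exact_mod_cast this
  have hcard : H.edgeSet.ncard = #E := by
    rw [← Set.ncard_coe_finset, ← Set.ncard_image_of_injective _ (coe_injective (α := Fin n))]
    congr 1
    ext e
    simp only [E, coe_filter, mem_univ, true_and, Set.mem_image, Set.mem_ofPred_eq]
    exact ⟨fun he => ⟨e.toFinite.toFinset, by simpa using he, by simp⟩,
      fun ⟨e', he', h⟩ => h ▸ he'⟩
  have hfree : F.Free (robustGraph E L) := by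
    intro hcon
    obtain ⟨H', hU', hB, hsub⟩ := exists_bergeCopy_of_copy E k r L hkr hE le_rfl hcon
    have hedge : H'.edgeSet ⊆ H.edgeSet := by
      intro e he
      obtain ⟨e', he', rfl⟩ := hsub e he
      simpa [E] using he'
    exact hC H' ⟨hU', hB⟩ ⟨hV ▸ Set.subset_univ _, hedge⟩
  have h1 := card_le_card_cliqueFinset_robustGraph_add E r L hr hE
  have h2 := hN (robustGraph E L) hfree
  rw [Fintype.card_fin] at h1
  omega

end BergeHypergraph

/-! ### Asymptotics -/

section Asymptotics

open Filter Topology Finset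

lemma tendsto_nat_div_div_atTop (s : ℕ) (hs : 0 < s) :
    Tendsto (fun n : ℕ => ((n / s : ℕ) : ℝ) / n) atTop (𝓝 (1 / s)) := by
  have h := (tendsto_nat_floor_mul_div_atTop (R := ℝ) (a := 1 / s) (by positivity)).comp
    tendsto_natCast_atTop_atTop
  refine h.congr fun n => ?_
  simp only [Function.comp_apply]
  rw [one_div_mul_eq_div, Nat.floor_div_natCast, Nat.floor_natCast]

end Asymptotics

theorem corollary4p3 {V : Type*} [Finite V] (F₀ : SimpleGraph V) (k r m : ℕ)
    (hk : 2 ≤ k) (hkr : k < r) (hrm : r < m) (hm : F₀.chromaticNumber = (m : ℕ∞)) :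
    Asymptotics.IsEquivalent Filter.atTop
      (fun n : ℕ => (BergeHypergraph.ex r n
        (BergeHypergraph.bergeFamily r (BergeHypergraph.expansion F₀ k) (Fin n)) : ℝ))
      (fun n : ℕ => ((BergeHypergraph.turanHypergraph r n (m - 1)).edgeSet.ncard : ℝ)) := by
  obtain ⟨s, rfl⟩ : ∃ s, m = s + 1 := ⟨m - 1, by omega⟩
  rw [Nat.add_sub_cancel]
  have hs : 0 < s := by omega
  obtain ⟨hcol, hncol⟩ := SimpleGraph.chromaticNumber_eq_iff_colorable_not_colorable.1 hm
  set c : ℝ := s.choose r / (s : ℝ) ^ r with hc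
  have hc0 : 0 < c := by
    have := Nat.choose_pos (show r ≤ s by omega)
    positivity
  set x : ℕ → ℝ := fun n => (BergeHypergraph.ex r n
    (BergeHypergraph.bergeFamily r (BergeHypergraph.expansion F₀ k) (Fin n)) : ℝ)
  set t : ℕ → ℝ := fun n => ((BergeHypergraph.turanHypergraph r n s).edgeSet.ncard : ℝ)
  have htx (n : ℕ) : t n ≤ x n :=
    Nat.cast_le.2 (BergeHypergraph.ncard_turanHypergraph_le_ex F₀ k r n s hs hncol)
  have hlow (n : ℕ) : (s.choose r : ℝ) * (((n / s : ℕ) : ℝ) / n) ^ r ≤ t n / (n : ℝ) ^ r := by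
    rw [div_pow, ← mul_div_assoc]
    gcongr
    simp only [t]
    rw [BergeHypergraph.ncard_edgeSet_turanHypergraph r n s hs]
    exact_mod_cast SimpleGraph.choose_mul_div_pow_le_card_cliqueFinset_turanGraph n s r hs
  have hlim : Filter.Tendsto (fun n : ℕ => (s.choose r : ℝ) * (((n / s : ℕ) : ℝ) / n) ^ r)
      Filter.atTop (nhds c) := by
    have h := ((tendsto_nat_div_div_atTop s hs).pow r).const_mul (s.choose r : ℝ)
    rwa [one_div, inv_pow, ← div_eq_mul_inv] at h
  have hup (ε : ℝ) (hε : 0 < ε) : ∀ᶠ n : ℕ in Filter.atTop, x n / (n : ℝ) ^ r ≤ c + ε := by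
    obtain ⟨L, hL⟩ := BergeHypergraph.exists_ex_le F₀ k r (by omega) hkr.le
    obtain ⟨N, hN⟩ := SimpleGraph.exists_card_cliqueFinset_le_of_free_of_colorable F₀ s hs hcol r
      (by omega) (ε / 2) (by positivity)
    obtain ⟨M, hM⟩ := exists_nat_ge (2 * L / ε)
    filter_upwards [Filter.eventually_ge_atTop (max (max N M) 1)] with n hn
    have hn0 : (0 : ℝ) < n := by
      have : 1 ≤ n := (le_max_right _ _).trans hn
      exact_mod_cast this
    have hNn : N ≤ n := (le_max_left _ _).trans ((le_max_left _ _).trans hn)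
    have hMn : (M : ℝ) ≤ n := by
      exact_mod_cast (le_max_right N M).trans ((le_max_left _ _).trans hn)
    have h1 := hL n ⌊(c + ε / 2) * (n : ℝ) ^ r⌋₊ fun G _ hG => by
      refine Nat.le_floor ?_
      have := hN (Fin n) G (by rwa [Fintype.card_fin]) hG
      rwa [Fintype.card_fin] at this
    have h2 : x n ≤ (c + ε / 2) * (n : ℝ) ^ r + L * (n : ℝ) ^ (r - 1) := by
      have h3 : x n ≤ (⌊(c + ε / 2) * (n : ℝ) ^ r⌋₊ : ℝ) + L * (n : ℝ) ^ (r - 1) := by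
        have h := (Nat.cast_le (α := ℝ)).2 h1
        rwa [Nat.cast_add, Nat.cast_mul, Nat.cast_pow] at h
      have h4 := Nat.floor_le (show 0 ≤ (c + ε / 2) * (n : ℝ) ^ r by positivity)
      linarith
    rw [div_le_iff₀ (by positivity)]
    have h5 : L * (n : ℝ) ^ (r - 1) ≤ ε / 2 * (n : ℝ) ^ r := by
      have h6 : (L : ℝ) ≤ ε / 2 * n := by
        have := hM.trans hMn
        rw [div_le_iff₀ hε] at this
        linarith
      obtain ⟨q, rfl⟩ : ∃ q, r = q + 1 := ⟨r - 1, by omega⟩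
      rw [Nat.add_sub_cancel, pow_succ]
      calc (L : ℝ) * (n : ℝ) ^ q ≤ ε / 2 * n * (n : ℝ) ^ q := by gcongr
        _ = _ := by ring
    linarith
  have hle (n : ℕ) : t n / (n : ℝ) ^ r ≤ x n / (n : ℝ) ^ r := by
    have := htx n
    gcongr
  have hx : Filter.Tendsto (fun n => x n / (n : ℝ) ^ r) Filter.atTop (nhds c) := by
    rw [tendsto_order]
    refine ⟨fun a ha => ?_, fun a ha => ?_⟩
    · filter_upwards [hlim.eventually_const_lt ha] with n hn
      exact hn.trans_le ((hlow n).trans (hle n))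
    · filter_upwards [hup ((a - c) / 2) (by linarith)] with n hn
      linarith
  have ht : Filter.Tendsto (fun n => t n / (n : ℝ) ^ r) Filter.atTop (nhds c) :=
    tendsto_of_tendsto_of_tendsto_of_le_of_le hlim hx hlow hle
  refine Asymptotics.isEquivalent_of_tendsto_one ?_
  have hdiv := hx.div ht hc0.ne'
  rw [div_self hc0.ne'] at hdiv
  refine hdiv.congr' ?_
  filter_upwards [Filter.eventually_gt_atTop 0] with n hn
  have : ((n : ℝ) ^ r) ≠ 0 := by positivity
  simp only [Pi.div_apply]
  exact div_div_div_cancel_right₀ this _ _
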